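/- Fix $n$ and let $\mathscr C$ be a concept class over $\{0,1\}^n$, that is, a set of functions $c:\{0,1\}^n\to\{0,1\}$. For a probability distribution $D$ on $\{0,1\}^{n+1}$ and $h:\{0,1\}^n\to\{0,1\}$ put $\mathrm{err}_D(h)=\Pr_{(x,b)\sim D}[h(x)\neq b]$ and $\mathrm{opt}_D(\mathscr C)=\min_{c\in\mathscr C}\mathrm{err}_D(c)$. A quantum learner with sample complexity $T$ is given $T$ copies of the quantum example $\sum_{(x,b)\in\{0,1\}^{n+1}}\sqrt{D(x,b)}\,|x,b\rangle$ and applies to them a joint POVM with finitely many outcomes, each of which is associated with an output hypothesis $h:\{0,1\}^n\to\{0,1\}$ (which need not belong to $\mathscr C$; learners that always output $h\in\mathscr C$ are included). It is an $(\varepsilon,\delta)$-agnostic quantum learner for $\mathscr C$ if for every distribution $D$ on $\{0,1\}^{n+1}$ its output $h$ satisfies $\mathrm{err}_D(h)\le \mathrm{opt}_D(\mathscr C)+\varepsilon$ with probability at least $1-\delta$. **Theorem.** There are universal constants $\kappa>0$ and $d_0\in\mathbb N$ such that for every $n$, every concept class $\mathscr C$ over $\{0,1\}^n$ of VC dimension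 $d\ge d_0$, every $\delta\in(0,1/2)$ and every $\varepsilon\in(0,1/10)$, every $(\varepsilon,\delta)$-agnostic quantum learner for $\mathscr C$ has sample complexity $$T\;\ge\;\kappa\left(\frac{d}{\varepsilon^2}+\frac{1}{\varepsilon^2}\log_2\frac1\delta\right).$$ -/

import Mathlib

open scoped ComplexOrder Matrix

noncomputable section

/-- A concept (or hypothesis) over `{0,1}^n`. -/
abbrev BoolConcept (n : ℕ) : Type := (Fin n → Bool) → Bool

/-- A labelled example `(x, b) ∈ {0,1}^n × {0,1} = {0,1}^(n+1)`. -/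
abbrev LabeledExample (n : ℕ) : Type := (Fin n → Bool) × Bool

/-- The Vapnik-Chervonenkis dimension of a concept class: Mathlib's `Finset.vcDim`, where a concept
`c` is identified with the set `{x | c x = 1}`. -/
def conceptVCDim {n : ℕ} (C : Finset (BoolConcept n)) : ℕ :=
  (C.image fun c => Finset.univ.filter fun x => c x = true).vcDim

/-- `err_D(h) = Pr_{(x,b) ∼ D}[h(x) ≠ b]`. -/
def agnosticErr {n : ℕ} (D : LabeledExample n → ℝ) (h : BoolConcept n) : ℝ :=
  ∑ z : LabeledExample n with h z.1 ≠ z.2, D z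

/-- `opt_D(C) = min_{c ∈ C} err_D(c)`; the minimum exists because a nonempty `C` is finite. -/
def agnosticOpt {n : ℕ} (D : LabeledExample n → ℝ) (C : Finset (BoolConcept n)) : ℝ :=
  sInf (agnosticErr D '' (C : Set (BoolConcept n)))

/-- The quantum example `∑_{(x,b)} √D(x,b) |x,b⟩`, as its vector of amplitudes. -/
def quantumExample {n : ℕ} (D : LabeledExample n → ℝ) : LabeledExample n → ℂ :=
  fun z => ((Real.sqrt (D z) : ℝ) : ℂ)

/-- The `T`-fold tensor power `|ψ⟩^{⊗T}` of a vector, in the product basis. -/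
def tensorPow {ι : Type*} (ψ : ι → ℂ) (T : ℕ) : (Fin T → ι) → ℂ :=
  fun w => ∏ t, ψ (w t)

/-- A quantum learner: it asks for `samples` quantum examples and measures them jointly with a
POVM with finitely many outcomes, each outcome being associated with an output hypothesis. -/
structure QuantumLearner (n : ℕ) where
  /-- the number of quantum examples used (the sample complexity) -/
  samples : ℕ
  /-- the number of outcomes of the POVM -/
  outcomes : ℕ
  /-- the POVM elements -/
  povm : Fin outcomes →
    Matrix (Fin samples → LabeledExample n) (Fin samples → LabeledExample n) ℂ
  povm_posSemidef : ∀ i, (povm i).PosSemidef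
  povm_sum : ∑ i, povm i = 1
  /-- the hypothesis that is output on each measurement outcome -/
  hypothesis : Fin outcomes → BoolConcept n

namespace QuantumLearner

variable {n : ℕ}

/-- The probability `⟨ψ|M_i|ψ⟩` of outcome `i`, where `|ψ⟩` consists of `samples` copies of the
quantum example for `D`. -/
def outcomeProb (A : QuantumLearner n) (D : LabeledExample n → ℝ) (i : Fin A.outcomes) : ℝ :=
  (star (tensorPow (quantumExample D) A.samples) ⬝ᵥ
    (A.povm i *ᵥ tensorPow (quantumExample D) A.samples)).re

open Classical in
/-- The probability that the hypothesis output by the learner satisfies `P`. -/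
def outputProb (A : QuantumLearner n) (D : LabeledExample n → ℝ) (P : BoolConcept n → Prop) : ℝ :=
  ∑ i with P (A.hypothesis i), A.outcomeProb D i

/-- `(ε,δ)`-agnostic quantum learner for `C`: for every distribution `D` on `{0,1}^(n+1)`, with
probability at least `1 - δ` the output `h` has error at most `opt_D(C) + ε`. The hypothesis is
not required to lie in `C`; learners that output `h ∈ C` are a special case, see
`IsProperAgnosticLearner.isAgnosticLearner`. -/
def IsAgnosticLearner (A : QuantumLearner n) (C : Finset (BoolConcept n)) (ε δ : ℝ) : Prop :=
  ∀ D ∈ stdSimplex ℝ (LabeledExample n),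
    1 - δ ≤ A.outputProb D fun h => agnosticErr D h ≤ agnosticOpt D C + ε

/-- The variant where the successful output hypothesis has to come from `C`. -/
def IsProperAgnosticLearner (A : QuantumLearner n) (C : Finset (BoolConcept n)) (ε δ : ℝ) : Prop :=
  ∀ D ∈ stdSimplex ℝ (LabeledExample n),
    1 - δ ≤ A.outputProb D fun h => h ∈ C ∧ agnosticErr D h ≤ agnosticOpt D C + ε

theorem outcomeProb_nonneg (A : QuantumLearner n) (D : LabeledExample n → ℝ)
    (i : Fin A.outcomes) : 0 ≤ A.outcomeProb D i :=
  (A.povm_posSemidef i).re_dotProduct_nonneg _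

theorem IsProperAgnosticLearner.isAgnosticLearner {A : QuantumLearner n}
    {C : Finset (BoolConcept n)} {ε δ : ℝ} (h : A.IsProperAgnosticLearner C ε δ) :
    A.IsAgnosticLearner C ε δ := by
  classical
  intro D hD
  refine (h D hD).trans ?_
  unfold outputProb
  refine Finset.sum_le_sum_of_subset_of_nonneg ?_ fun i _ _ => A.outcomeProb_nonneg D i
  intro i hi
  simp only [Finset.mem_filter, Finset.mem_univ, true_and] at hi ⊢
  exact hi.2

end QuantumLearner

end

open scoped ComplexOrder Matrix

/-! Let `s` be shattered with `d` points. Hide a labelling `a` in the distribution `noisyLabels s β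
a`, with `β` of order `ε`. Shattering puts a concept equal to `a` on `s` into the class, so a
successful output agrees with `a` on most of `s`. But flipping one bit of `a` costs fidelity only
`4β²/d` per copy (`one_sub_le_bhattacharyya_flipAt`), and measurement cannot decrease fidelity
(`bhattacharyya_pow_le`). If `T` is small compared with `d/ε²`, the agreements at two distinct
points are therefore nearly uncorrelated for average `a`, so the squared total agreement is far
below `d²` (`sum_secondMoment_le`), while success forces order `d²` (`le_secondMoment`). The
logarithmic term comes from distinguishing two opposite biases at a single point. -/

/-! ### Fidelity of weights and of quantum examples. -/

theorem Matrix.PosSemidef.exists_eq_conjTranspose_mul_self {m : Type*} [Fintype m] [DecidableEq m]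
    {M : Matrix m m ℂ} (hM : M.PosSemidef) : ∃ B : Matrix m m ℂ, M = Bᴴ * B := by
  open scoped MatrixOrder Matrix.Norms.L2Operator in
  exact CStarAlgebra.nonneg_iff_eq_star_mul_self.mp hM.nonneg

/-- Cauchy–Schwarz for the semi-inner product of `M`, transported to the standard one by `M = Bᴴ *
B`. -/
theorem Matrix.PosSemidef.re_dotProduct_mulVec_le {m : Type*} [Fintype m] [DecidableEq m]
    {M : Matrix m m ℂ} (hM : M.PosSemidef) (v w : m → ℂ) :
    (star v ⬝ᵥ (M *ᵥ w)).re ≤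
      √(star v ⬝ᵥ (M *ᵥ v)).re * √(star w ⬝ᵥ (M *ᵥ w)).re := by
  obtain ⟨B, rfl⟩ := hM.exists_eq_conjTranspose_mul_self
  have key : ∀ x y : m → ℂ, star x ⬝ᵥ ((Bᴴ * B) *ᵥ y) =
      inner ℂ (WithLp.toLp 2 (B *ᵥ x)) (WithLp.toLp 2 (B *ᵥ y)) := by
    intro x y
    rw [EuclideanSpace.inner_eq_star_dotProduct, ← Matrix.mulVec_mulVec, Matrix.dotProduct_mulVec,
      ← Matrix.star_mulVec, dotProduct_comm]
  have hn : ∀ x : m → ℂ,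
      √(star x ⬝ᵥ ((Bᴴ * B) *ᵥ x)).re = ‖WithLp.toLp 2 (B *ᵥ x)‖ := by
    intro x
    rw [key]
    exact (norm_eq_sqrt_re_inner (𝕜 := ℂ) _).symm
  rw [hn, hn, key]
  exact (Complex.re_le_norm _).trans (norm_inner_le_norm _ _)

theorem star_tensorPow_dotProduct {ι : Type*} [Fintype ι] (ψ φ : ι → ℂ) (T : ℕ) :
    star (tensorPow ψ T) ⬝ᵥ tensorPow φ T = (star ψ ⬝ᵥ φ) ^ T := by
  classical
  simp only [dotProduct, tensorPow, Pi.star_apply, star_prod, ← Finset.prod_mul_distrib]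
  exact (Fintype.sum_pow (fun x => star (ψ x) * φ x) T).symm

/-- The Bhattacharyya coefficient (classical fidelity) of two nonnegative weights. -/
noncomputable def bhattacharyya {ι : Type*} [Fintype ι] (p q : ι → ℝ) : ℝ :=
  ∑ i, √(p i) * √(q i)

theorem star_quantumExample_dotProduct {n : ℕ} (D D' : LabeledExample n → ℝ) :
    star (quantumExample D) ⬝ᵥ quantumExample D' = (bhattacharyya D D' : ℂ) := by
  simp [dotProduct, quantumExample, bhattacharyya]

theorem bhattacharyya_self {ι : Type*} [Fintype ι] {p : ι → ℝ} (hp : ∀ i, 0 ≤ p i) :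
    bhattacharyya p p = ∑ i, p i :=
  Finset.sum_congr rfl fun i _ => Real.mul_self_sqrt (hp i)

/-- Splitting the sum over an event and its complement. -/
theorem bhattacharyya_le {ι : Type*} [Fintype ι] {p q : ι → ℝ}
    (hp : ∀ i, 0 ≤ p i) (hq : ∀ i, 0 ≤ q i) [DecidableEq ι] (S : Finset ι) :
    bhattacharyya p q ≤ √(∑ i ∈ S, p i) * √(∑ i ∈ S, q i) +
      √(∑ i ∈ Sᶜ, p i) * √(∑ i ∈ Sᶜ, q i) := by
  unfold bhattacharyya
  rw [← Finset.sum_add_sum_compl S]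
  exact add_le_add (Real.sum_sqrt_mul_sqrt_le _ hp hq) (Real.sum_sqrt_mul_sqrt_le _ hp hq)

/-- Weights that are distinguished by an event with error at most `δ` have small fidelity. -/
theorem bhattacharyya_le_two_mul_sqrt {ι : Type*} [Fintype ι] [DecidableEq ι] {p q : ι → ℝ}
    (hp : ∀ i, 0 ≤ p i) (hq : ∀ i, 0 ≤ q i) (hp1 : ∑ i, p i = 1) (hq1 : ∑ i, q i = 1)
    {δ : ℝ} (S : Finset ι) (hS : 1 - δ ≤ ∑ i ∈ S, p i) (hS' : 1 - δ ≤ ∑ i ∈ Sᶜ, q i) :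
    bhattacharyya p q ≤ 2 * √δ := by
  rw [← Finset.sum_add_sum_compl S] at hp1 hq1
  have n1 : 0 ≤ ∑ i ∈ Sᶜ, p i := Finset.sum_nonneg fun i _ => hp i
  have n2 : 0 ≤ ∑ i ∈ S, q i := Finset.sum_nonneg fun i _ => hq i
  have e1 : √(∑ i ∈ S, p i) ≤ 1 := Real.sqrt_le_one.mpr (by linarith)
  have e2 : √(∑ i ∈ S, q i) ≤ √δ := Real.sqrt_le_sqrt (by linarith)
  have e3 : √(∑ i ∈ Sᶜ, p i) ≤ √δ := Real.sqrt_le_sqrt (by linarith)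
  have e4 : √(∑ i ∈ Sᶜ, q i) ≤ 1 := Real.sqrt_le_one.mpr (by linarith)
  calc bhattacharyya p q ≤ _ := bhattacharyya_le hp hq S
    _ ≤ 1 * √δ + √δ * 1 := add_le_add
        (mul_le_mul e1 e2 (Real.sqrt_nonneg _) zero_le_one)
        (mul_le_mul e3 e4 (Real.sqrt_nonneg _) (Real.sqrt_nonneg _))
    _ = 2 * √δ := by ring

/-- Factor `p - q = (√p - √q)(√p + √q)` and apply Cauchy–Schwarz. -/
theorem sum_abs_sub_le_bhattacharyya {ι : Type*} [Fintype ι] {p q : ι → ℝ}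
    (hp : ∀ i, 0 ≤ p i) (hq : ∀ i, 0 ≤ q i) (hp1 : ∑ i, p i = 1) (hq1 : ∑ i, q i = 1) :
    ∑ i, |p i - q i| ≤ 2 * √(2 - 2 * bhattacharyya p q) := by
  have h1 : ∑ i, (√(p i) - √(q i)) ^ 2 = 2 - 2 * bhattacharyya p q := by
    simp only [sub_sq, Real.sq_sqrt (hp _), Real.sq_sqrt (hq _), Finset.sum_add_distrib,
      Finset.sum_sub_distrib, hp1, hq1, bhattacharyya, mul_assoc, ← Finset.mul_sum]
    ring
  have h2 : ∑ i, (√(p i) + √(q i)) ^ 2 ≤ 4 := by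
    calc ∑ i, (√(p i) + √(q i)) ^ 2 ≤ ∑ i, (2 * p i + 2 * q i) := by
          refine Finset.sum_le_sum fun i _ => ?_
          nlinarith [sq_nonneg (√(p i) - √(q i)), Real.sq_sqrt (hp i), Real.sq_sqrt (hq i)]
      _ = 4 := by
          rw [Finset.sum_add_distrib, ← Finset.mul_sum, ← Finset.mul_sum, hp1, hq1]; norm_num
  have h3 : ∀ i, |p i - q i| = |√(p i) - √(q i)| * |√(p i) + √(q i)| := by
    intro i
    rw [← abs_mul]
    congr 1
    nlinarith [Real.sq_sqrt (hp i), Real.sq_sqrt (hq i)]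
  calc ∑ i, |p i - q i| = ∑ i, |√(p i) - √(q i)| * |√(p i) + √(q i)| :=
        Finset.sum_congr rfl fun i _ => h3 i
    _ ≤ √(∑ i, |√(p i) - √(q i)| ^ 2) * √(∑ i, |√(p i) + √(q i)| ^ 2) :=
        Real.sum_mul_le_sqrt_mul_sqrt _ _ _
    _ ≤ √(2 - 2 * bhattacharyya p q) * 2 := by
        simp only [sq_abs, h1]
        refine mul_le_mul_of_nonneg_left ?_ (Real.sqrt_nonneg _)
        exact Real.sqrt_le_iff.mpr ⟨by norm_num, h2.trans (by norm_num)⟩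
    _ = _ := mul_comm _ _

/-! ### Outcome statistics of the measurement. -/

namespace QuantumLearner

variable {n : ℕ}

theorem star_dotProduct_eq_sum_povm (A : QuantumLearner n)
    (v w : (Fin A.samples → LabeledExample n) → ℂ) :
    star v ⬝ᵥ w = ∑ i, star v ⬝ᵥ (A.povm i *ᵥ w) := by
  rw [← dotProduct_sum, ← Matrix.sum_mulVec, A.povm_sum, Matrix.one_mulVec]

theorem sum_outcomeProb (A : QuantumLearner n) {D : LabeledExample n → ℝ}
    (hD : D ∈ stdSimplex ℝ (LabeledExample n)) : ∑ i, A.outcomeProb D i = 1 := by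
  unfold outcomeProb
  rw [← Complex.re_sum, ← star_dotProduct_eq_sum_povm, star_tensorPow_dotProduct,
    star_quantumExample_dotProduct, bhattacharyya_self hD.1, hD.2]
  simp

/-- Measuring cannot decrease the fidelity of `samples` copies of two quantum examples. -/
theorem bhattacharyya_pow_le (A : QuantumLearner n) (D D' : LabeledExample n → ℝ) :
    bhattacharyya D D' ^ A.samples ≤ bhattacharyya (A.outcomeProb D) (A.outcomeProb D') := by
  have h := A.star_dotProduct_eq_sum_povm (tensorPow (quantumExample D) A.samples)
    (tensorPow (quantumExample D') A.samples)
  rw [star_tensorPow_dotProduct, star_quantumExample_dotProduct] at h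
  have h' := congrArg Complex.re h
  rw [← Complex.ofReal_pow, Complex.ofReal_re, Complex.re_sum] at h'
  rw [h']
  exact Finset.sum_le_sum fun i _ => (A.povm_posSemidef i).re_dotProduct_mulVec_le _ _

theorem sum_abs_outcomeProb_sub_le (A : QuantumLearner n) {D D' : LabeledExample n → ℝ}
    (hD : D ∈ stdSimplex ℝ (LabeledExample n)) (hD' : D' ∈ stdSimplex ℝ (LabeledExample n)) :
    ∑ i, |A.outcomeProb D i - A.outcomeProb D' i| ≤
      2 * √(2 - 2 * bhattacharyya D D' ^ A.samples) := by
  refine (sum_abs_sub_le_bhattacharyya (A.outcomeProb_nonneg D) (A.outcomeProb_nonneg D')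
    (A.sum_outcomeProb hD) (A.sum_outcomeProb hD')).trans ?_
  have := A.bhattacharyya_pow_le D D'
  gcongr

end QuantumLearner

/-! ### Hard distributions on a shattered set. -/

variable {n : ℕ}

/-- The distribution on labelled examples with uniform marginal on `s`, whose label agrees with `a`
with probability `1/2 + β`. -/
noncomputable def noisyLabels (s : Finset (Fin n → Bool)) (β : ℝ) (a : BoolConcept n) :
    LabeledExample n → ℝ :=
  fun z => if z.1 ∈ s then (1 / 2 + if a z.1 = z.2 then β else -β) / s.card else 0

theorem noisyLabels_mem_stdSimplex {s : Finset (Fin n → Bool)} (hs : s.Nonempty) {β : ℝ}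
    (hβ : |β| ≤ 1 / 2) (a : BoolConcept n) :
    noisyLabels s β a ∈ stdSimplex ℝ (LabeledExample n) := by
  have hb := abs_le.mp hβ
  constructor
  · intro z
    unfold noisyLabels
    split_ifs <;> first | exact le_rfl | exact div_nonneg (by linarith) (Nat.cast_nonneg _)
  · have hc : (s.card : ℝ) ≠ 0 := by exact_mod_cast hs.card_ne_zero
    have : ∀ y, ∑ b, noisyLabels s β a (y, b) = if y ∈ s then 1 / (s.card : ℝ) else 0 := by
      intro y
      by_cases hy : y ∈ s
      · cases h : a y <;> simp [noisyLabels, hy, h] <;> ring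
      · simp [noisyLabels, hy]
    rw [Fintype.sum_prod_type]
    simp only [this, Finset.sum_ite_mem, Finset.univ_inter, Finset.sum_const, nsmul_eq_mul]
    field_simp

theorem agnosticErr_eq_sum (D : LabeledExample n → ℝ) (h : BoolConcept n) :
    agnosticErr D h = ∑ x, D (x, !h x) := by
  unfold agnosticErr
  rw [Finset.sum_filter, Fintype.sum_prod_type]
  refine Finset.sum_congr rfl fun x _ => ?_
  cases hx : h x <;> simp [hx]

theorem agnosticErr_noisyLabels {s : Finset (Fin n → Bool)} (hs : s.Nonempty) (β : ℝ)
    (a h : BoolConcept n) :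
    agnosticErr (noisyLabels s β a) h =
      1 / 2 - β + 2 * β * ({x ∈ s | h x ≠ a x} : Finset _).card / s.card := by
  have hc : (s.card : ℝ) ≠ 0 := by exact_mod_cast hs.card_ne_zero
  have key : ∀ x, noisyLabels s β a (x, !h x) =
      if x ∈ s then (1 / 2 - β) / s.card + (2 * β / s.card) * (if h x ≠ a x then 1 else 0)
      else 0 := by
    intro x
    by_cases hx : x ∈ s
    · cases h1 : a x <;> cases h2 : h x <;> simp [noisyLabels, hx, h1] <;> ring
    · simp [noisyLabels, hx]
  rw [agnosticErr_eq_sum]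
  simp only [key, Finset.sum_ite_mem, Finset.univ_inter, Finset.sum_add_distrib, ← Finset.mul_sum,
    Finset.sum_boole, Finset.sum_const, nsmul_eq_mul]
  field_simp

theorem agnosticOpt_le {C : Finset (BoolConcept n)} {c : BoolConcept n} (hc : c ∈ C)
    (D : LabeledExample n → ℝ) : agnosticOpt D C ≤ agnosticErr D c :=
  csInf_le ((C.finite_toSet.image _).bddBelow) ⟨c, hc, rfl⟩

theorem exists_concept_of_shatters {C : Finset (BoolConcept n)} {s : Finset (Fin n → Bool)}
    (hs : (C.image fun c => Finset.univ.filter fun x => c x = true).Shatters s)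
    (a : BoolConcept n) : ∃ c ∈ C, ∀ x ∈ s, c x = a x := by
  obtain ⟨u, hu, hsu⟩ := hs (Finset.filter_subset (fun x => a x = true) s)
  obtain ⟨c, hc, rfl⟩ := Finset.mem_image.mp hu
  refine ⟨c, hc, fun x hx => ?_⟩
  have := Finset.ext_iff.mp hsu x
  simp only [Finset.mem_inter, Finset.mem_filter, Finset.mem_univ, true_and, hx] at this
  exact Bool.eq_iff_iff.mpr this

/-- Shattering gives optimum at most `1/2 - β`, and each disagreement on `s` adds `2β / s.card` to
the error. -/
theorem card_disagree_le_of_agnosticErr_le {C : Finset (BoolConcept n)}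
    {s : Finset (Fin n → Bool)} (hne : s.Nonempty)
    (hs : (C.image fun c => Finset.univ.filter fun x => c x = true).Shatters s)
    {β ε : ℝ} {a h : BoolConcept n}
    (hh : agnosticErr (noisyLabels s β a) h ≤ agnosticOpt (noisyLabels s β a) C + ε) :
    2 * β * ({x ∈ s | h x ≠ a x} : Finset _).card ≤ ε * s.card := by
  obtain ⟨c, hc, hca⟩ := exists_concept_of_shatters hs a
  have h1 := agnosticOpt_le hc (noisyLabels s β a)
  rw [agnosticErr_noisyLabels hne] at h1 hh
  have h2 : ({x ∈ s | c x ≠ a x} : Finset _) = ∅ := by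
    simpa [Finset.filter_eq_empty_iff] using hca
  rw [h2] at h1
  have hpos : (0 : ℝ) < s.card := by exact_mod_cast hne.card_pos
  rw [← div_le_iff₀ hpos]
  simp at h1
  linarith

/-- The concept obtained by negating the value at `x`. -/
def flipAt (x : Fin n → Bool) (a : BoolConcept n) : BoolConcept n :=
  Function.update a x (!a x)

theorem flipAt_self (x : Fin n → Bool) (a : BoolConcept n) : flipAt x a x = !a x := by
  simp [flipAt]

theorem flipAt_of_ne {x y : Fin n → Bool} (h : y ≠ x) (a : BoolConcept n) :
    flipAt x a y = a y := by
  simp [flipAt, h]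

theorem flipAt_involutive (x : Fin n → Bool) :
    Function.Involutive (flipAt x : BoolConcept n → BoolConcept n) := by
  intro a
  simp [flipAt]

/-- The two distributions differ only over `x`, where the label probabilities `1/2 ± β` are swapped.
-/
theorem one_sub_le_bhattacharyya_flipAt {s : Finset (Fin n → Bool)} (hs : s.Nonempty)
    {β : ℝ} (hβ : |β| ≤ 1 / 2) (a : BoolConcept n) {x : Fin n → Bool} (hx : x ∈ s) :
    1 - 4 * β ^ 2 / s.card ≤
      bhattacharyya (noisyLabels s β a) (noisyLabels s β (flipAt x a)) := by
  have hb := abs_le.mp hβ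
  have hc : (0 : ℝ) < s.card := by exact_mod_cast hs.card_pos
  have hβ2 : 4 * β ^ 2 ≤ 1 := by nlinarith
  -- This is `u ≤ √u` on `[0, 1]`, for `u = 1 - 4β²`.
  have hsqrt : (1 - 4 * β ^ 2) / 2 ≤ √(1 / 2 + β) * √(1 / 2 - β) := by
    rw [← Real.sqrt_mul (by linarith)]
    apply Real.le_sqrt_of_sq_le
    nlinarith [sq_nonneg β]
  have hmul : ∀ u v : ℝ, √(u / s.card) * √(v / s.card) = √u * √v / s.card := by
    intro u v
    rw [Real.sqrt_div' _ hc.le, Real.sqrt_div' _ hc.le, div_mul_div_comm, Real.mul_self_sqrt hc.le]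
  have key : ∀ y, (if y ∈ s then (1 / (s.card : ℝ) - if y = x then 4 * β ^ 2 / s.card else 0) else 0) ≤
      ∑ b, √(noisyLabels s β a (y, b)) * √(noisyLabels s β (flipAt x a) (y, b)) := by
    intro y
    by_cases hy : y ∈ s
    · by_cases hyx : y = x
      · subst hyx
        have : ∑ b, √(noisyLabels s β a (y, b)) * √(noisyLabels s β (flipAt y a) (y, b)) =
            2 * (√(1 / 2 + β) * √(1 / 2 - β)) / s.card := by
          cases h : a y <;>
          simp only [noisyLabels, hy, if_true, hmul, flipAt_self, h, Fintype.sum_bool] <;>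
          simp [← sub_eq_add_neg] <;> ring
        rw [this]
        simp only [hy, if_true, ← sub_div]
        gcongr
        linarith
      · have h1 : 0 ≤ 1 / 2 + β := by linarith
        have h2 : 0 ≤ 1 / 2 - β := by linarith
        have : ∑ b, √(noisyLabels s β a (y, b)) * √(noisyLabels s β (flipAt x a) (y, b)) =
            1 / (s.card : ℝ) := by
          have e : ∀ b, noisyLabels s β (flipAt x a) (y, b) = noisyLabels s β a (y, b) := by
            intro b; simp [noisyLabels, flipAt_of_ne hyx]
          simp only [e, Real.mul_self_sqrt ((noisyLabels_mem_stdSimplex hs hβ a).1 _)]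
          cases h : a y <;> simp [noisyLabels, hy, h] <;> ring
        rw [this]
        simp [hy, hyx]
    · simp [noisyLabels, hy]
  unfold bhattacharyya
  rw [Fintype.sum_prod_type]
  refine le_trans (le_of_eq ?_) (Finset.sum_le_sum fun y _ => key y)
  rw [Finset.sum_ite_mem, Finset.univ_inter, Finset.sum_sub_distrib, Finset.sum_ite_eq' s x,
    if_pos hx, Finset.sum_const, nsmul_eq_mul, mul_one_div_cancel hc.ne']
-- Second moment of the agreement, and the `d/ε²` bound.
/-- `1` if `h` and `a` agree at `x`, and `-1` otherwise. -/
noncomputable def agreement (h a : BoolConcept n) (x : Fin n → Bool) : ℝ :=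
  if h x = a x then 1 else -1

theorem agreement_sq (h a : BoolConcept n) (x : Fin n → Bool) :
    agreement h a x * agreement h a x = 1 := by
  unfold agreement; split_ifs <;> norm_num

theorem abs_agreement (h a : BoolConcept n) (x : Fin n → Bool) : |agreement h a x| = 1 := by
  unfold agreement; split_ifs <;> norm_num

theorem agreement_flipAt_self (h a : BoolConcept n) (x : Fin n → Bool) :
    agreement h (flipAt x a) x = -agreement h a x := by
  unfold agreement
  rw [flipAt_self]
  cases h x <;> cases a x <;> norm_num

theorem agreement_flipAt_of_ne {x y : Fin n → Bool} (hxy : y ≠ x) (h a : BoolConcept n) :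
    agreement h (flipAt x a) y = agreement h a y := by
  unfold agreement
  rw [flipAt_of_ne hxy]

theorem sum_agreement (s : Finset (Fin n → Bool)) (h a : BoolConcept n) :
    ∑ x ∈ s, agreement h a x = s.card - 2 * ({x ∈ s | h x ≠ a x} : Finset _).card := by
  have : ∀ x, agreement h a x = 1 - 2 * (if h x ≠ a x then 1 else 0) := by
    intro x; unfold agreement; by_cases e : h x = a x <;> simp [e]; norm_num
  simp only [this, Finset.sum_sub_distrib, ← Finset.mul_sum, Finset.sum_boole, Finset.sum_const,
    nsmul_eq_mul, mul_one]

namespace QuantumLearner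

/-- The expected squared total agreement of the output with `a`, on noisy labels for `a`. -/
noncomputable def secondMoment (A : QuantumLearner n) (s : Finset (Fin n → Bool)) (β : ℝ)
    (a : BoolConcept n) : ℝ :=
  ∑ i, A.outcomeProb (noisyLabels s β a) i * (∑ x ∈ s, agreement (A.hypothesis i) a x) ^ 2

/-- Pair `a` with `flipAt x a`: the product of agreements changes sign while the outcome
distribution barely moves, so the two contributions nearly cancel. -/
theorem sum_correlation_le (A : QuantumLearner n) {s : Finset (Fin n → Bool)} (hs : s.Nonempty)
    {β : ℝ} (hβ : |β| ≤ 1 / 2) {x y : Fin n → Bool} (hx : x ∈ s) (hxy : y ≠ x) :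
    ∑ a, ∑ i, A.outcomeProb (noisyLabels s β a) i *
        (agreement (A.hypothesis i) a x * agreement (A.hypothesis i) a y) ≤
      Fintype.card (BoolConcept n) *
        √(2 - 2 * (1 - 4 * β ^ 2 / s.card) ^ A.samples) := by
  set f : BoolConcept n → ℝ := fun a => ∑ i, A.outcomeProb (noisyLabels s β a) i *
        (agreement (A.hypothesis i) a x * agreement (A.hypothesis i) a y) with hf
  set R := √(2 - 2 * (1 - 4 * β ^ 2 / s.card) ^ A.samples)
  have hc : (1 : ℝ) ≤ s.card := by exact_mod_cast hs.card_pos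
  have hb := abs_le.mp hβ
  have hfid : 0 ≤ 1 - 4 * β ^ 2 / s.card := by
    rw [sub_nonneg, div_le_one (by linarith)]
    nlinarith
  have hpair : ∀ a, f a + f (flipAt x a) ≤ 2 * R := by
    intro a
    calc f a + f (flipAt x a) = ∑ i, (A.outcomeProb (noisyLabels s β a) i -
            A.outcomeProb (noisyLabels s β (flipAt x a)) i) *
          (agreement (A.hypothesis i) a x * agreement (A.hypothesis i) a y) := by
          simp only [hf, agreement_flipAt_self, agreement_flipAt_of_ne hxy]
          rw [← Finset.sum_add_distrib]
          exact Finset.sum_congr rfl fun i _ => by ring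
      _ ≤ ∑ i, |A.outcomeProb (noisyLabels s β a) i -
            A.outcomeProb (noisyLabels s β (flipAt x a)) i| := by
          refine Finset.sum_le_sum fun i _ => (le_abs_self _).trans_eq ?_
          rw [abs_mul, abs_mul, abs_agreement, abs_agreement, mul_one, mul_one]
      _ ≤ 2 * √(2 - 2 * bhattacharyya (noisyLabels s β a)
            (noisyLabels s β (flipAt x a)) ^ A.samples) :=
          A.sum_abs_outcomeProb_sub_le (noisyLabels_mem_stdSimplex hs hβ _)
            (noisyLabels_mem_stdSimplex hs hβ _)
      _ ≤ 2 * R := by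
          have := pow_le_pow_left₀ hfid (one_sub_le_bhattacharyya_flipAt hs hβ a hx) A.samples
          have h2 := Real.sqrt_le_sqrt (sub_le_sub_left (mul_le_mul_of_nonneg_left this
            (zero_le_two (α := ℝ))) 2)
          linarith
  have hflip : ∑ a, f (flipAt x a) = ∑ a, f a :=
    Equiv.sum_comp (flipAt_involutive x).toPerm f
  have hsum := Finset.sum_le_sum fun a (_ : a ∈ Finset.univ) => hpair a
  rw [Finset.sum_add_distrib, hflip, Finset.sum_const, nsmul_eq_mul, Finset.card_univ] at hsum
  linarith

theorem sum_secondMoment_le (A : QuantumLearner n) {s : Finset (Fin n → Bool)} (hs : s.Nonempty)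
    {β : ℝ} (hβ : |β| ≤ 1 / 2) :
    ∑ a, A.secondMoment s β a ≤ Fintype.card (BoolConcept n) *
      (s.card + s.card ^ 2 * √(2 - 2 * (1 - 4 * β ^ 2 / s.card) ^ A.samples)) := by
  set R := √(2 - 2 * (1 - 4 * β ^ 2 / s.card) ^ A.samples) with hR
  set N : ℝ := (Fintype.card (BoolConcept n) : ℝ)
  have hN : 0 ≤ N := Nat.cast_nonneg _
  have hR0 : 0 ≤ R := Real.sqrt_nonneg _
  have expand : ∑ a, A.secondMoment s β a = ∑ x ∈ s, ∑ y ∈ s, ∑ a, ∑ i,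
      A.outcomeProb (noisyLabels s β a) i *
        (agreement (A.hypothesis i) a x * agreement (A.hypothesis i) a y) := by
    simp only [secondMoment, sq, Finset.sum_mul_sum]
    simp only [Finset.mul_sum]
    calc _ = ∑ a, ∑ x ∈ s, ∑ y ∈ s, ∑ i, A.outcomeProb (noisyLabels s β a) i *
        (agreement (A.hypothesis i) a x * agreement (A.hypothesis i) a y) := by
          refine Finset.sum_congr rfl fun a _ => ?_
          rw [Finset.sum_comm]
          exact Finset.sum_congr rfl fun x _ => Finset.sum_comm
      _ = _ := by
          rw [Finset.sum_comm]
          exact Finset.sum_congr rfl fun x _ => Finset.sum_comm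
  have hterm : ∀ x ∈ s, ∀ y ∈ s, (∑ a, ∑ i, A.outcomeProb (noisyLabels s β a) i *
        (agreement (A.hypothesis i) a x * agreement (A.hypothesis i) a y)) ≤
      N * R + if y = x then N else 0 := by
    intro x hx y _
    by_cases hxy : y = x
    · subst hxy
      simp only [agreement_sq, mul_one, if_true,
        A.sum_outcomeProb (noisyLabels_mem_stdSimplex hs hβ _), Finset.sum_const,
        Finset.card_univ, nsmul_eq_mul]
      exact le_add_of_nonneg_left (mul_nonneg hN hR0)
    · rw [if_neg hxy, add_zero]
      exact A.sum_correlation_le hs hβ hx hxy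
  rw [expand]
  calc _ ≤ ∑ x ∈ s, ∑ y ∈ s, (N * R + if y = x then N else 0) :=
        Finset.sum_le_sum fun x hx => Finset.sum_le_sum fun y hy => hterm x hx y hy
    _ = ∑ x ∈ s, (s.card * (N * R) + N) := by
        refine Finset.sum_congr rfl fun x hx => ?_
        rw [Finset.sum_add_distrib, Finset.sum_ite_eq' s x, if_pos hx, Finset.sum_const,
          nsmul_eq_mul]
    _ = N * (s.card + s.card ^ 2 * R) := by
        rw [Finset.sum_const, nsmul_eq_mul]; ring

/-- With `β = 4ε`, success leaves at most `s.card / 8` disagreements, hence total agreement at least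
`3/4 * s.card`. Squaring makes failed outcomes contribute nonnegatively, which matters for `δ` near
`1/2`. -/
theorem IsAgnosticLearner.le_secondMoment {A : QuantumLearner n} {C : Finset (BoolConcept n)}
    {ε δ : ℝ} (hA : A.IsAgnosticLearner C ε δ) {s : Finset (Fin n → Bool)} (hne : s.Nonempty)
    (hs : (C.image fun c => Finset.univ.filter fun x => c x = true).Shatters s)
    (hε : 0 < ε) (hε' : 4 * ε ≤ 1 / 2) (a : BoolConcept n) :
    (1 - δ) * (9 / 16 * (s.card : ℝ) ^ 2) ≤ A.secondMoment s (4 * ε) a := by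
  classical
  have hβ : |4 * ε| ≤ 1 / 2 := by rwa [abs_of_pos (by linarith)]
  have h1 := hA _ (noisyLabels_mem_stdSimplex hne hβ a)
  unfold outputProb at h1
  calc _ ≤ _ := mul_le_mul_of_nonneg_right h1 (by positivity)
    _ ≤ _ := by
      rw [Finset.sum_mul]
      refine (Finset.sum_le_sum fun i hi => ?_).trans
        (Finset.sum_le_sum_of_subset_of_nonneg (Finset.filter_subset _ _)
          fun i _ _ => mul_nonneg (A.outcomeProb_nonneg _ i) (sq_nonneg _))
      refine mul_le_mul_of_nonneg_left ?_ (A.outcomeProb_nonneg _ i)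
      have h2 := card_disagree_le_of_agnosticErr_le hne hs (Finset.mem_filter.mp hi).2
      rw [sum_agreement]
      have h3 : 8 * (({x ∈ s | A.hypothesis i x ≠ a x} : Finset _).card : ℝ) ≤ s.card := by
        refine le_of_mul_le_mul_left ?_ hε
        linarith
      have h4 : (0 : ℝ) ≤ s.card := Nat.cast_nonneg _
      nlinarith

theorem IsAgnosticLearner.card_div_sq_le {A : QuantumLearner n} {C : Finset (BoolConcept n)}
    {ε δ : ℝ} (hA : A.IsAgnosticLearner C ε δ) {s : Finset (Fin n → Bool)}
    (hs : (C.image fun c => Finset.univ.filter fun x => c x = true).Shatters s)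
    (hcard : 8 ≤ s.card) (hδ : δ ≤ 1 / 2) (hε : 0 < ε) (hε' : 4 * ε ≤ 1 / 2) :
    (s.card : ℝ) / ε ^ 2 ≤ 6000 * A.samples := by
  have hne : s.Nonempty := Finset.card_pos.mp (by omega)
  have hβ : |4 * ε| ≤ 1 / 2 := by rwa [abs_of_pos (by linarith)]
  have hd : (8 : ℝ) ≤ s.card := by exact_mod_cast hcard
  set d : ℝ := (s.card : ℝ)
  have hlow := Finset.sum_le_sum fun a (_ : a ∈ Finset.univ) =>
    hA.le_secondMoment hne hs hε hε' a
  have hup := hlow.trans (A.sum_secondMoment_le hne hβ)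
  rw [Finset.sum_const, nsmul_eq_mul, Finset.card_univ] at hup
  have h1 := le_of_mul_le_mul_left hup (by exact_mod_cast Fintype.card_pos)
  have hpow : 1 - A.samples * (4 * (4 * ε) ^ 2 / d) ≤
      (1 - 4 * (4 * ε) ^ 2 / d) ^ A.samples := by
    have : -2 ≤ -(4 * (4 * ε) ^ 2 / d) := by
      rw [neg_le_neg_iff, div_le_iff₀ (by linarith)]
      nlinarith
    have := one_add_mul_le_pow this A.samples
    rwa [← sub_eq_add_neg, mul_neg, ← sub_eq_add_neg] at this
  -- `5/32 = 9/32 - 4/32`: half of `9/16`, minus the diagonal term `d ≤ d²/8`.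
  have h2 : (5 : ℝ) / 32 ≤ √(2 - 2 * (1 - 4 * (4 * ε) ^ 2 / d) ^ A.samples) := by
    have h3 : (1 / 2 : ℝ) * (9 / 16 * d ^ 2) ≤ (1 - δ) * (9 / 16 * d ^ 2) := by
      gcongr; linarith
    have h4 : d ≤ d ^ 2 / 8 := by nlinarith
    refine le_of_mul_le_mul_left (a := d ^ 2) ?_ (by positivity)
    linarith
  have h3 := Real.le_sqrt' (by norm_num : (0 : ℝ) < 5 / 32) |>.mp h2
  have h4 : (25 : ℝ) / 1024 ≤ 128 * (A.samples * ε ^ 2) / d := by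
    calc (25 : ℝ) / 1024 ≤ 2 * (A.samples * (4 * (4 * ε) ^ 2 / d)) := by linarith
      _ = _ := by ring
  rw [le_div_iff₀ (by linarith)] at h4
  rw [div_le_iff₀ (by positivity)]
  linarith

/-! ### The confidence term. -/

theorem IsAgnosticLearner.logb_div_sq_le {A : QuantumLearner n} {C : Finset (BoolConcept n)}
    {ε δ : ℝ} (hA : A.IsAgnosticLearner C ε δ) {x : Fin n → Bool}
    (hs : (C.image fun c => Finset.univ.filter fun x => c x = true).Shatters {x})
    (hδ : 0 < δ) (hδ' : δ ≤ 1 / 16) (hε : 0 < ε) (hε' : ε ≤ 1 / 10) :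
    1 / ε ^ 2 * Real.logb 2 (1 / δ) ≤ 64 * A.samples := by
  classical
  have hne : ({x} : Finset (Fin n → Bool)).Nonempty := Finset.singleton_nonempty x
  have hβ : |ε| ≤ 1 / 2 := by rw [abs_of_pos hε]; linarith
  let a : BoolConcept n := fun _ => true
  let a' := flipAt x a
  let D := noisyLabels {x} ε a
  let D' := noisyLabels {x} ε a'
  have hD : D ∈ stdSimplex ℝ (LabeledExample n) := noisyLabels_mem_stdSimplex hne hβ a
  have hD' : D' ∈ stdSimplex ℝ (LabeledExample n) := noisyLabels_mem_stdSimplex hne hβ a'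
  have good : ∀ b h : BoolConcept n,
      agnosticErr (noisyLabels {x} ε b) h ≤ agnosticOpt (noisyLabels {x} ε b) C + ε →
      h x = b x := by
    intro b h hh
    by_contra hne'
    -- A wrong bit at the only point would cost `2ε`, more than the allowed `ε`.
    have := card_disagree_le_of_agnosticErr_le hne hs hh
    simp [Finset.filter_singleton, hne'] at this
    linarith
  let S : Finset (Fin A.outcomes) := {i | A.hypothesis i x = true}
  have hS : 1 - δ ≤ ∑ i ∈ S, A.outcomeProb D i := by
    refine (hA D hD).trans (Finset.sum_le_sum_of_subset_of_nonneg ?_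
      fun i _ _ => A.outcomeProb_nonneg _ i)
    intro i hi
    simpa [S] using good a _ (Finset.mem_filter.mp hi).2
  have hS' : 1 - δ ≤ ∑ i ∈ Sᶜ, A.outcomeProb D' i := by
    refine (hA D' hD').trans (Finset.sum_le_sum_of_subset_of_nonneg ?_
      fun i _ _ => A.outcomeProb_nonneg _ i)
    intro i hi
    simpa [S, a', a, flipAt_self] using good a' _ (Finset.mem_filter.mp hi).2
  have hBC : bhattacharyya (A.outcomeProb D) (A.outcomeProb D') ≤ 2 * √δ :=
    bhattacharyya_le_two_mul_sqrt (A.outcomeProb_nonneg D) (A.outcomeProb_nonneg D')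
      (A.sum_outcomeProb hD) (A.sum_outcomeProb hD') S hS hS'
  have hfid := one_sub_le_bhattacharyya_flipAt hne hβ a (Finset.mem_singleton_self x)
  rw [Finset.card_singleton, Nat.cast_one, div_one] at hfid
  have hexp : Real.exp (-(8 * ε ^ 2)) ≤ 1 - 4 * ε ^ 2 := by
    have h0 : 4 * ε ^ 2 ≤ 1 / 2 := by nlinarith
    have h1 : (1 : ℝ) ≤ (1 - 4 * ε ^ 2) * (8 * ε ^ 2 + 1) := by nlinarith [sq_nonneg ε]
    have h2 : (1 : ℝ) ≤ (1 - 4 * ε ^ 2) * Real.exp (8 * ε ^ 2) :=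
      h1.trans (mul_le_mul_of_nonneg_left (Real.add_one_le_exp _) (by linarith))
    rw [Real.exp_neg, inv_le_iff_one_le_mul₀ (Real.exp_pos _)]
    exact h2
  have hfinal : Real.exp (-(A.samples * (8 * ε ^ 2))) ≤ 2 * √δ := by
    calc _ = Real.exp (-(8 * ε ^ 2)) ^ A.samples := by rw [← Real.exp_nat_mul]; ring_nf
      _ ≤ bhattacharyya D D' ^ A.samples :=
        pow_le_pow_left₀ (Real.exp_pos _).le (hexp.trans hfid) _
      _ ≤ _ := (A.bhattacharyya_pow_le D D').trans hBC
  have hlog := Real.log_le_log (Real.exp_pos _) hfinal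
  rw [Real.log_exp, Real.log_mul (by norm_num) (Real.sqrt_pos.mpr hδ).ne',
    Real.log_sqrt hδ.le] at hlog
  -- Absorbs the factor 2 of `2√δ`: `log 2 + (log δ)/2 ≤ (log δ)/4`.
  have hδlog : Real.log δ ≤ -(4 * Real.log 2) := by
    calc Real.log δ ≤ Real.log (1 / 16) := Real.log_le_log hδ hδ'
      _ = -(4 * Real.log 2) := by
        rw [one_div, Real.log_inv, show (16 : ℝ) = 2 ^ 4 by norm_num, Real.log_pow]; norm_num
  have hl2 : (1 : ℝ) / 2 ≤ Real.log 2 := by linarith [Real.log_two_gt_d9]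
  rw [Real.logb, one_div_mul_eq_div, div_div, div_le_iff₀ (by positivity), one_div, Real.log_inv]
  have : (64 * (A.samples : ℝ)) * (1 / 2 * ε ^ 2) ≤ 64 * A.samples * (Real.log 2 * ε ^ 2) := by
    gcongr
  linarith

end QuantumLearner

/-! ### Combining the two bounds. -/

theorem mainTheorem2 :
    ∃ κ : ℝ, 0 < κ ∧ ∃ d₀ : ℕ, ∀ (n d : ℕ) (C : Finset (BoolConcept n)),
      conceptVCDim C = d → d₀ ≤ d →
        ∀ δ ∈ Set.Ioo (0 : ℝ) (1 / 2), ∀ ε ∈ Set.Ioo (0 : ℝ) (1 / 10),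
          ∀ A : QuantumLearner n, A.IsAgnosticLearner C ε δ →
            κ * ((d : ℝ) / ε ^ 2 + 1 / ε ^ 2 * Real.logb 2 (1 / δ)) ≤ (A.samples : ℝ) := by
  -- `9000 = 6000 + 3000`, one summand per term; `8 ≤ d` serves both `d ≤ d²/8` and `4 ≤ d/2`.
  refine ⟨1 / 9000, by norm_num, 8, ?_⟩
  rintro n d C hd hd8 δ ⟨hδ0, hδ⟩ ε ⟨hε0, hε⟩ A hA
  set 𝒜 := C.image fun c => Finset.univ.filter fun x => c x = true with h𝒜
  obtain ⟨s, hs, hcard⟩ : ∃ s, 𝒜.Shatters s ∧ s.card = d := by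
    have hne : 𝒜.shatterer.Nonempty := by
      by_contra hemp
      rw [Finset.not_nonempty_iff_eq_empty] at hemp
      rw [conceptVCDim, Finset.vcDim, ← h𝒜, hemp, Finset.sup_empty, Nat.bot_eq_zero] at hd
      omega
    obtain ⟨s, hs, hsup⟩ := Finset.exists_mem_eq_sup _ hne Finset.card
    exact ⟨s, Finset.mem_shatterer.mp hs, hsup.symm.trans hd⟩
  have h1 := hA.card_div_sq_le hs (by omega) hδ.le hε0 (by linarith)
  rw [hcard] at h1
  suffices 1 / ε ^ 2 * Real.logb 2 (1 / δ) ≤ 3000 * A.samples by linarith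
  rcases le_or_gt δ (1 / 16) with h16 | h16
  · obtain ⟨x, hx⟩ : s.Nonempty := Finset.card_pos.mp (by omega)
    have := hA.logb_div_sq_le (hs.mono_right (Finset.singleton_subset_iff.mpr hx)) hδ0 h16 hε0 hε.le
    linarith [(Nat.cast_nonneg A.samples : (0 : ℝ) ≤ A.samples)]
  -- For `δ > 1/16` the confidence term is at most half of `d/ε²`.
  · have hlog : Real.logb 2 (1 / δ) ≤ 4 := by
      rw [Real.logb_le_iff_le_rpow (by norm_num) (by positivity), div_le_iff₀ hδ0]
      norm_num
      linarith
    have hd' : (8 : ℝ) ≤ d := by exact_mod_cast hd8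
    have : 1 / ε ^ 2 * Real.logb 2 (1 / δ) ≤ 1 / 2 * (d / ε ^ 2) := by
      rw [one_div_mul_eq_div, ← mul_div_assoc]
      gcongr
      linarith
    linarith
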